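/- **Setting.** Let $d\ge 2$, $W=\{y\in\mathbb R^{d+1}:\sum_i y_i=0\}$, $\alpha_i=e_i-e_{d+1}$ $(1\le i\le d)$, $A_d=\bigoplus_i\mathbb Z\alpha_i$, $p=\frac1{d+1}\sum_{i=1}^d\alpha_i$, $\beta_0=-p$ and $\beta_i=\alpha_i-p$. The $d$-dimensional diamond crystal $\Delta_d$ has vertex set $V=A_d\sqcup(A_d+p)$; its edges join $a$ to $a+\beta_i$ for $a\in A_d+p$ and $0\le i\le d$, and such an edge has label $i+1$. Let $J_1,\dots,J_{d+1}\in\mathbb R$. **Majorana operators and Hamiltonian.** Let $\mathcal C$ be the complex Clifford algebra with generators $c_k^v$ $(v\in V,\ 1\le k\le d+2)$ and relations $c_k^vc_l^w+c_l^wc_k^v=2\delta_{vw}\delta_{kl}$; write $c_v=c^v_{d+2}$ and $\sigma_v^k=\sqrt{-1}\,c_k^vc_v$. The Hamiltonian of the Kitaev model is the formal sum over the edges $$H=-\sum_{\text{edges }(v,v')}J_k\,\sigma_v^k\sigma_{v'}^k,\qquad k=\text{label of }(v,v'),$$ which acts on $\mathcal C$ by the commutator $[H,X]$ (only finitely many terms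 are nonzero for each $X\in\mathcal C$). For an edge with label $k$ joining $v\in A_d+p$ to $v'\in A_d$ put $\hat u_{v,v'}=\sqrt{-1}\,c_k^vc_k^{v'}$. **Gauge sector.** Let $S$ be a representation of $\mathcal C$ on a complex vector space with a total parity operator $\widetilde D$, that is, a linear involution of $S$ that anticommutes with every $c_k^v$. The gauge sector $M_+(\Delta_d)\subseteq S$ is the space of all $u$ with $\widetilde Du=u$ and $\hat u_{v,v'}u=u$ for all edges. **Energy functions.** The Hamiltonian acts on the modes over $M_+(\Delta_d)$ by a matrix $(h_{wv})_{w,v\in V}$ with finitely supported columns such that $[H,c_v]\,u=\sum_w h_{wv}\,c_w u$ for all $v\in V$ and $u\in M_+(\Delta_d)$; on functions on $V$ it acts by $(hf)(w)=\sum_v h_{wv}f(v)$. For $q\in W^*$, a number $\xi\in\mathbb C$ is a value at $q$ of a minimum ground state energy function if $hf=\xi f$ for such a matrix $h$ and some nonzero $f:V\to\mathbb C^{\nu(d)}$, $\nu(d)=2^{\lfloor d/2\rfloor}$, satisfying the Bloch condition $f(v+\alpha_i)=e^{\sqrt{-1}\,q\cdot\alpha_i}f(v)$ for all $v\in V$,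 $1\le i\le d$. **Theorem.** (a) There is an irreducible representation $S$ of $\mathcal C$ with a total parity operator for which $M_+(\Delta_d)\ne0$. (b) For every representation $S$ of $\mathcal C$ with a total parity operator for which $M_+(\Delta_d)\neq0$, irreducible or not, the matrix $h$ exists and is unique, and for every $q\in W^*$ the values at $q$ of the minimum ground state energy functions are exactly $$\xi(q)=\pm2\Bigl|J_1+\sum_{i=1}^dJ_{i+1}e^{\sqrt{-1}\,q\cdot\alpha_i}\Bigr|.$$ -/

import Mathlib

namespace DiamondKitaev

noncomputable section

/-! ### The diamond crystal -/

/-- The space `W` of vectors of `ℝ^{d+1}` whose coordinates sum to zero. -/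
def W (d : ℕ) : Submodule ℝ (Fin (d + 1) → ℝ) where
  carrier := {y | ∑ i, y i = 0}
  add_mem' := by
    intro a b ha hb
    simp only [Set.mem_ofPred_eq, Pi.add_apply, Finset.sum_add_distrib] at *
    rw [ha, hb, add_zero]
  zero_mem' := by simp
  smul_mem' := by
    intro c x hx
    simp only [Set.mem_ofPred_eq, Pi.smul_apply, smul_eq_mul] at *
    rw [← Finset.mul_sum, hx, mul_zero]

/-- The vector `α_i = e_i - e_{d+1}`, for `1 ≤ i ≤ d` (indexed by `Fin d`). -/
def alpha {d : ℕ} (i : Fin d) : W d :=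
  ⟨Pi.single i.castSucc 1 - Pi.single (Fin.last d) 1, by
    change ∑ j, (Pi.single i.castSucc (1 : ℝ) - Pi.single (Fin.last d) (1 : ℝ) :
      Fin (d + 1) → ℝ) j = 0
    simp [Finset.sum_sub_distrib]⟩

/-- The root lattice `A_d`, the subgroup of `W` generated by the `α_i`. -/
def rootLattice (d : ℕ) : AddSubgroup (W d) :=
  AddSubgroup.closure (Set.range (alpha (d := d)))

/-- The shift `p = (α_1 + ⋯ + α_d) / (d + 1)`. -/
def shift (d : ℕ) : W d := ((d : ℝ) + 1)⁻¹ • ∑ i, alpha i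

/-- The vertices of the diamond crystal: the points of `A_d` and those of `A_d + p`. -/
def Vertex (d : ℕ) : Type :=
  {x : W d // x ∈ rootLattice d ∨ x - shift d ∈ rootLattice d}

/-- The vectors `β_0 = -p` and `β_i = α_i - p` for `1 ≤ i ≤ d`. -/
def beta {d : ℕ} (i : Fin (d + 1)) : W d :=
  Fin.cases (-shift d) (fun j => alpha j - shift d) i

theorem beta_add_shift_mem {d : ℕ} (i : Fin (d + 1)) :
    beta i + shift d ∈ rootLattice d := by
  refine Fin.cases ?_ (fun j => ?_) i
  · simp [beta]
  · have h : alpha j ∈ rootLattice d := AddSubgroup.subset_closure (Set.mem_range_self j)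
    simpa [beta] using h

/-- Translation of a vertex by `α_i`. -/
def translate {d : ℕ} (i : Fin d) (v : Vertex d) : Vertex d :=
  ⟨v.1 + alpha i, by
    have h : alpha i ∈ rootLattice d := AddSubgroup.subset_closure (Set.mem_range_self i)
    rcases v.2 with hv | hv
    · exact Or.inl (add_mem hv h)
    · right
      rw [add_sub_right_comm]
      exact add_mem hv h⟩

/-- The edges of the diamond crystal. The edge with origin `a ∈ A_d + p` and direction `i` joins
`a` to `a + β_i ∈ A_d`; it lies above the edge `e_i` of the base graph and has label `i + 1`. -/
structure Edge (d : ℕ) where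
  /-- the end point in `A_d + p` -/
  origin : W d
  origin_mem : origin - shift d ∈ rootLattice d
  /-- the direction `i`, `0 ≤ i ≤ d` -/
  dir : Fin (d + 1)

/-- The end point in `A_d + p` of an edge. -/
def Edge.source {d : ℕ} (e : Edge d) : Vertex d := ⟨e.origin, Or.inr e.origin_mem⟩

/-- The end point in `A_d` of an edge. -/
def Edge.target {d : ℕ} (e : Edge d) : Vertex d :=
  ⟨e.origin + beta e.dir, Or.inl (by
    have h := add_mem e.origin_mem (beta_add_shift_mem e.dir)
    rwa [show e.origin - shift d + (beta e.dir + shift d) = e.origin + beta e.dir by abel] at h)⟩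

/-! ### Majorana operators -/

/-- The quadratic form `x ↦ ∑ x_j²` on finitely supported families indexed by `ι`. -/
def sumSqForm (ι : Type) : QuadraticForm ℂ (ι →₀ ℂ) :=
  LinearMap.BilinMap.toQuadraticMap
    ((Finsupp.bilinearCombination ℂ ℂ (M := ℂ) (α := ι)).comp Finsupp.lcoeFun)

theorem sumSqForm_apply {ι : Type} (x : ι →₀ ℂ) :
    sumSqForm ι x = x.sum fun _ a => a * a := by
  simp only [sumSqForm, LinearMap.BilinMap.toQuadraticMap_apply, LinearMap.comp_apply,
    Finsupp.bilinearCombination_apply, Finsupp.linearCombination_apply]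
  rfl

/-- The algebra of Majorana operators of the crystal: the Clifford algebra with one copy of the
generators `c_1, …, c_{d+2}` at every vertex. It is the graded tensor product over the vertices of
copies of `Cl_{d+2}`, so that Majorana operators at different vertices anticommute. -/
abbrev MajoranaAlgebra (d : ℕ) : Type :=
  CliffordAlgebra (sumSqForm (Vertex d × Fin (d + 2)))

/-- The Majorana operator `c_k^v`; the index `k : Fin (d + 2)` stands for `k + 1`. -/
def majorana {d : ℕ} (v : Vertex d) (k : Fin (d + 2)) : MajoranaAlgebra d :=
  CliffordAlgebra.ι _ (Finsupp.single (v, k) 1)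

/-- The Majorana operator `c_v = c_{d+2}^v`. -/
def matter {d : ℕ} (v : Vertex d) : MajoranaAlgebra d := majorana v (Fin.last (d + 1))

/-- The spin operator `σ_v^k = √-1 c_k^v c_{d+2}^v`, `1 ≤ k ≤ d + 1`. -/
def spin {d : ℕ} (v : Vertex d) (k : Fin (d + 1)) : MajoranaAlgebra d :=
  Complex.I • (majorana v k.castSucc * matter v)

/-- The link operator `û = √-1 c_k^v c_k^{v'}` of an edge with label `k`, where `v ∈ A_d + p` and
`v' ∈ A_d`. -/
def link {d : ℕ} (e : Edge d) : MajoranaAlgebra d :=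
  Complex.I • (majorana e.source e.dir.castSucc * majorana e.target e.dir.castSucc)

/-! ### The Hamiltonian -/

/-- The summand `-J_k σ_v^k σ_{v'}^k` of the Hamiltonian attached to an edge with label `k`. The
coupling constant `J_{i+1}` of the direction `i` is `J i`. -/
def hamiltonianTerm {d : ℕ} (J : Fin (d + 1) → ℝ) (e : Edge d) : MajoranaAlgebra d :=
  -((J e.dir : ℂ) • (spin e.source e.dir * spin e.target e.dir))

/-- The commutator `[H, X]` with the Hamiltonian `H`, the formal sum over all edges of the
`-J_k σ_v^k σ_{v'}^k`. For `X` a polynomial in the Majorana operators only the finitely many edges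
that meet the vertices occurring in `X` contribute. -/
def commutatorH {d : ℕ} (J : Fin (d + 1) → ℝ) (X : MajoranaAlgebra d) : MajoranaAlgebra d :=
  ∑ᶠ e : Edge d, (hamiltonianTerm J e * X - X * hamiltonianTerm J e)

/-! ### States -/

section States

variable {d : ℕ} {S : Type*} [AddCommGroup S] [Module ℂ S] [Module (MajoranaAlgebra d) S]
  [IsScalarTower ℂ (MajoranaAlgebra d) S]

/-- `D` is a total parity operator on the representation `S`: an involution that anticommutes with
every Majorana operator, as the product over all vertices of the local parities does. -/
def IsTotalParity (D : S →ₗ[ℂ] S) : Prop :=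
  (∀ u, D (D u) = u) ∧
    ∀ (v : Vertex d) (k : Fin (d + 2)) (u : S), D (majorana v k • u) = -(majorana v k • D u)

/-- The gauge sector `M_+`: the states fixed by the total parity and by all link operators. -/
def gaugeSector (D : S →ₗ[ℂ] S) : Submodule ℂ S where
  carrier := {u | D u = u ∧ ∀ e : Edge d, link e • u = u}
  add_mem' := by
    rintro a b ⟨ha, ha'⟩ ⟨hb, hb'⟩
    exact ⟨by rw [map_add, ha, hb], fun e => by rw [smul_add, ha', hb']⟩
  zero_mem' := ⟨map_zero D, fun e => smul_zero _⟩
  smul_mem' := by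
    rintro c x ⟨hx, hx'⟩
    refine ⟨by rw [map_smul, hx], fun e => ?_⟩
    rw [← algebraMap_smul (MajoranaAlgebra d) c x, ← mul_smul, ← Algebra.commutes, mul_smul, hx']

/-- `h` is the matrix by which the Hamiltonian acts on the Majorana operators `c_v` over the gauge
sector: `[H, c_v] = ∑_w h_{w v} c_w` on `M_+`, each column `h v` being finitely supported. -/
def IsMatrixOfH (J : Fin (d + 1) → ℝ) (D : S →ₗ[ℂ] S) (h : Vertex d → Vertex d →₀ ℂ) : Prop :=
  ∀ v : Vertex d, ∀ u ∈ gaugeSector (d := d) D,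
    commutatorH J (matter v) • u = (h v).sum fun w a => a • (matter w • u)

/-- The Bloch condition with quasimomentum `q ∈ W*`. -/
def IsBloch {n : ℕ} (q : Module.Dual ℝ (W d)) (f : Vertex d → EuclideanSpace ℂ (Fin n)) : Prop :=
  ∀ (i : Fin d) (v : Vertex d),
    f (translate i v) = Complex.exp (Complex.I * (q (alpha i) : ℂ)) • f v

/-- `ξ` is a value at `q` of a minimum ground state energy function: an eigenvalue of the
Hamiltonian on the modes `∑_v f(v) c_v` over the gauge sector, with a nonzero eigenfunction `f`
that has values in `ℂ^ν`, `ν = 2^⌊d/2⌋`, and satisfies the Bloch condition. -/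
def IsEnergyAt (J : Fin (d + 1) → ℝ) (D : S →ₗ[ℂ] S) (q : Module.Dual ℝ (W d)) (ξ : ℂ) : Prop :=
  ∃ h : Vertex d → Vertex d →₀ ℂ, IsMatrixOfH J D h ∧
    ∃ f : Vertex d → EuclideanSpace ℂ (Fin (2 ^ (d / 2))),
      f ≠ 0 ∧ IsBloch q f ∧ ∀ w, (∑ᶠ v, h v w • f v) = ξ • f w

end States

end

end DiamondKitaev

/-! Regrouping the Majorana factors of an edge term gives `-J_k σ σ' = √-1 J_k c_v c_{v'} û`. The
link operators commute with all matter operators and act as 1 on the gauge sector, so over that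
sector `H` is a quadratic free-fermion Hamiltonian in the `c_v`. Its commutator with `c_v` is a
combination of the `c_w` at the neighbours of `v`, which gives the matrix `hamiltonianMatrix`.

Uniqueness of the matrix says that a finite combination of matter operators killing the sector has
zero coefficients. A single `c_w` leaves the sector because it reverses the total parity, but
products of two preserve it (`matter_matter_smul_mem_gaugeSector`). Anticommuting the combination
past such a product isolates each coefficient (`eq_zero_of_annihilates_gaugeSector`); this uses a
vertex outside the support, hence an infinite crystal.

A Bloch function is determined by its values on one unit cell, one for each sublattice. On it the
matrix becomes the block with off-diagonal entries `2√-1 z` and `-2√-1 z̄`, where `z` is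
`structureFunction J q`. Hence `ξ² = 4|z|²`, whatever the number of components of the function
(`exists_isBloch_eigenfunction_iff`).

For existence, every `c_k^v` with `k ≤ d + 1` lies on exactly one edge with label `k`, so these
operators pair along edges; the matter operators pair within unit cells. Each pair is a fermionic
mode. On the Fock space of these modes a link operator is `1 - 2N`, with `N` the occupation number
of its mode, so the vacuum lies in the gauge sector. Irreducibility holds because annihilation
operators reduce any nonzero vector to a multiple of the vacuum and creation operators rebuild
everything from it. -/

namespace DiamondKitaev

noncomputable section

/-! ### Clifford relations -/

section Clifford

variable {ι : Type}

/-- The generator of the Clifford algebra of `sumSqForm ι` with index `j`. -/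
def gen (j : ι) : CliffordAlgebra (sumSqForm ι) :=
  CliffordAlgebra.ι _ (Finsupp.single j 1)

theorem gen_mul_self (j : ι) : gen j * gen j = 1 := by
  rw [gen, CliffordAlgebra.ι_sq_scalar, sumSqForm_apply]
  simp

theorem gen_mul_gen_of_ne {j l : ι} (h : j ≠ l) : gen j * gen l = -(gen l * gen j) := by
  classical
  rw [eq_neg_iff_add_eq_zero, gen, gen, CliffordAlgebra.ι_mul_ι_add_swap, sumSqForm,
    LinearMap.BilinMap.polar_toQuadraticMap]
  simp [Finsupp.bilinearCombination_apply, h, h.symm]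

/-- A bilinear form whose symmetrization agrees with that of `sumSqForm` on the standard basis
induces `sumSqForm`. -/
theorem apply_self_eq_sumSqForm (b : (ι →₀ ℂ) →ₗ[ℂ] (ι →₀ ℂ) →ₗ[ℂ] ℂ)
    (hb : ∀ j l, b (Finsupp.single j 1) (Finsupp.single l 1) +
      b (Finsupp.single l 1) (Finsupp.single j 1) = 2 * Finsupp.single j (1 : ℂ) l)
    (x : ι →₀ ℂ) : b x x = sumSqForm ι x := by
  classical
  let s : (ι →₀ ℂ) →ₗ[ℂ] (ι →₀ ℂ) →ₗ[ℂ] ℂ :=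
    (Finsupp.bilinearCombination ℂ ℂ (M := ℂ) (α := ι)).comp Finsupp.lcoeFun
  have h : b + b.flip = (2 : ℂ) • s := by
    ext j l
    have := hb j l
    simp only [s, LinearMap.comp_apply, LinearMap.add_apply, LinearMap.flip_apply,
      Finsupp.lsingle_apply, LinearMap.smul_apply, this, Finsupp.bilinearCombination_apply,
      smul_eq_mul]
    simp
  have h2 : b x x + b x x = 2 * s x x := by
    simpa using LinearMap.congr_fun (LinearMap.congr_fun h x) x
  have h3 : b x x = s x x := by linear_combination h2 / 2
  rw [h3]
  rfl

end Clifford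

/-! ### Fock representations -/

section Fock

/-- Fock space over the set of modes `K`: the exterior algebra on the modes. -/
def Fock (K : Type) : Type := ExteriorAlgebra ℂ (K →₀ ℂ)

instance (K : Type) : Ring (Fock K) := inferInstanceAs (Ring (ExteriorAlgebra ℂ (K →₀ ℂ)))
instance (K : Type) : Algebra ℂ (Fock K) :=
  inferInstanceAs (Algebra ℂ (ExteriorAlgebra ℂ (K →₀ ℂ)))
instance (K : Type) : Nontrivial (Fock K) :=
  inferInstanceAs (Nontrivial (ExteriorAlgebra ℂ (K →₀ ℂ)))

variable {ι K : Type}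

/-- The inclusion of the modes in Fock space. -/
def wedge : (K →₀ ℂ) →ₗ[ℂ] Fock K := ExteriorAlgebra.ι ℂ

/-- Contraction with a linear form on the modes. -/
def contract : Module.Dual ℂ (K →₀ ℂ) →ₗ[ℂ] Fock K →ₗ[ℂ] Fock K :=
  CliffordAlgebra.contractLeft

/-- The number parity of Fock space. -/
def parity : Fock K →ₐ[ℂ] Fock K := CliffordAlgebra.involute

theorem wedge_mul_self (a : K →₀ ℂ) : wedge a * wedge a = 0 := ExteriorAlgebra.ι_sq_zero a

theorem contract_wedge_mul (d : Module.Dual ℂ (K →₀ ℂ)) (a : K →₀ ℂ) (x : Fock K) :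
    contract d (wedge a * x) = d a • x - wedge a * contract d x :=
  CliffordAlgebra.contractLeft_ι_mul d a x

theorem contract_contract (d : Module.Dual ℂ (K →₀ ℂ)) (x : Fock K) :
    contract d (contract d x) = 0 :=
  CliffordAlgebra.contractLeft_contractLeft d x

theorem contract_one (d : Module.Dual ℂ (K →₀ ℂ)) : contract d (1 : Fock K) = 0 :=
  CliffordAlgebra.contractLeft_one _ d

theorem parity_wedge (a : K →₀ ℂ) : parity (wedge a) = -wedge a :=
  CliffordAlgebra.involute_ι a

theorem parity_parity (x : Fock K) : parity (parity x) = x :=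
  CliffordAlgebra.involute_involute x

theorem Fock.left_induction {P : Fock K → Prop} (scalar : ∀ r : ℂ, P (algebraMap ℂ _ r))
    (add : ∀ x y, P x → P y → P (x + y)) (wedge_mul : ∀ x a, P x → P (wedge a * x)) (x : Fock K) :
    P x :=
  CliffordAlgebra.left_induction (P := P) _ scalar add wedge_mul x

theorem contract_parity (d : Module.Dual ℂ (K →₀ ℂ)) (x : Fock K) :
    contract d (parity x) = -parity (contract d x) := by
  induction x using Fock.left_induction with
  | scalar r =>
    simp [Algebra.algebraMap_eq_smul_one, contract_one]
  | add x y hx hy => simp only [map_add, hx, hy, neg_add]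
  | wedge_mul x a hx =>
    rw [map_mul, parity_wedge, neg_mul, map_neg, contract_wedge_mul, contract_wedge_mul, hx]
    simp [parity_wedge]

theorem mul_wedge (x : Fock K) (a : K →₀ ℂ) : x * wedge a = wedge a * parity x := by
  induction x using Fock.left_induction with
  | scalar r => simp [Algebra.commutes]
  | add x y hx hy => rw [add_mul, hx, hy, map_add, mul_add]
  | wedge_mul x b hx =>
    have h : wedge b * wedge a = -(wedge a * wedge b) := by
      rw [eq_neg_iff_add_eq_zero]
      exact ExteriorAlgebra.ι_add_mul_swap b a
    rw [mul_assoc, hx, ← mul_assoc, h, map_mul, parity_wedge]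
    simp [mul_assoc]

/-- The creation operator of a mode, as an element of Fock space. -/
def mode (k : K) : Fock K := wedge (Finsupp.single k 1)

theorem wedge_single (k : K) (c : ℂ) : wedge (Finsupp.single k c) = c • mode k := by
  rw [mode, ← map_smul, Finsupp.smul_single, smul_eq_mul, mul_one]

theorem wedge_eq_sum_mode (a : K →₀ ℂ) : wedge a = ∑ k ∈ a.support, a k • mode k := by
  conv_lhs => rw [← Finsupp.sum_single a]
  rw [Finsupp.sum, map_sum]
  exact Finset.sum_congr rfl fun k _ => wedge_single k (a k)

/-- The subalgebra of Fock space generated by a set of modes. -/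
def modes (A : Set K) : Subalgebra ℂ (Fock K) := Algebra.adjoin ℂ (mode '' A)

theorem modes_mono {A B : Set K} (h : A ⊆ B) : modes A ≤ modes B :=
  Algebra.adjoin_mono (Set.image_mono h)

theorem mode_mem {A : Set K} {k : K} (h : k ∈ A) : mode k ∈ modes A :=
  Algebra.subset_adjoin (Set.mem_image_of_mem _ h)

theorem parity_mem_modes {A : Set K} {x : Fock K} (hx : x ∈ modes A) : parity x ∈ modes A := by
  have h : modes A ≤ (modes A).comap parity := by
    refine Algebra.adjoin_le ?_
    rintro _ ⟨k, hk, rfl⟩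
    change parity (mode k) ∈ modes A
    rw [mode, parity_wedge]
    exact neg_mem (mode_mem hk)
  exact h hx

theorem contract_eq_zero_of_mem_modes {A : Set K} {k : K} (hk : k ∉ A) {x : Fock K}
    (hx : x ∈ modes A) : contract (Finsupp.lapply k) x = 0 := by
  -- Phrased for left multiplication by `x`, the claim composes along products, so the contraction
  -- rule for one mode suffices; `y = 1` gives the lemma.
  have key : ∀ x ∈ modes A, ∀ y : Fock K, contract (Finsupp.lapply k) y = 0 →
      contract (Finsupp.lapply k) (x * y) = 0 := by
    intro x hx
    induction hx using Algebra.adjoin_induction with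
    | mem x hx =>
      obtain ⟨j, hj, rfl⟩ := hx
      intro y hy
      have : j ≠ k := fun h => hk (h ▸ hj)
      rw [mode, contract_wedge_mul, hy]
      simp [this]
    | algebraMap r =>
      intro y hy
      rw [← Algebra.smul_def, map_smul, hy, smul_zero]
    | add x x' _ _ hx hx' =>
      intro y hy
      rw [add_mul, map_add, hx y hy, hx' y hy, add_zero]
    | mul x x' _ _ hx hx' =>
      intro y hy
      rw [mul_assoc]
      exact hx _ (hx' y hy)
  simpa using key x hx 1 (contract_one _)

/-- The mode `k` squares to zero and moves left past any element at the cost of a parity sign, so at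
most one factor of it survives, in front. -/
theorem exists_eq_add_mode_mul {A : Set K} {k : K} {x : Fock K} (hx : x ∈ modes (insert k A)) :
    ∃ y ∈ modes A, ∃ z ∈ modes A, x = y + mode k * z := by
  induction hx using Algebra.adjoin_induction with
  | mem x hx =>
    obtain ⟨j, rfl | hj, rfl⟩ := hx
    · exact ⟨0, zero_mem _, 1, one_mem _, by simp⟩
    · exact ⟨mode j, mode_mem hj, 0, zero_mem _, by simp⟩
  | algebraMap r => exact ⟨_, Subalgebra.algebraMap_mem _ r, 0, zero_mem _, by simp⟩
  | add x x' _ _ hx hx' =>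
    obtain ⟨y, hy, z, hz, rfl⟩ := hx
    obtain ⟨y', hy', z', hz', rfl⟩ := hx'
    exact ⟨y + y', add_mem hy hy', z + z', add_mem hz hz', by rw [mul_add]; abel⟩
  | mul x x' _ _ hx hx' =>
    obtain ⟨y, hy, z, hz, rfl⟩ := hx
    obtain ⟨y', hy', z', hz', rfl⟩ := hx'
    refine ⟨y * y', mul_mem hy hy', z * y' + parity y * z',
      add_mem (mul_mem hz hy') (mul_mem (parity_mem_modes hy) hz'), ?_⟩
    have h1 : y * (mode k * z') = mode k * (parity y * z') := by
      rw [← mul_assoc, mode, mul_wedge, mul_assoc]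
    have h2 : mode k * z * (mode k * z') = 0 := by
      rw [mul_assoc, ← mul_assoc z, mode, mul_wedge, ← mul_assoc, ← mul_assoc, wedge_mul_self,
        zero_mul, zero_mul]
    rw [add_mul, mul_add, mul_add, h1, h2, mul_add, mul_assoc]
    abel

theorem exists_finset_mem_modes (x : Fock K) : ∃ A : Finset K, x ∈ modes (A : Set K) := by
  classical
  induction x using Fock.left_induction with
  | scalar r => exact ⟨∅, Subalgebra.algebraMap_mem _ r⟩
  | add x y hx hy =>
    obtain ⟨A, hA⟩ := hx
    obtain ⟨B, hB⟩ := hy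
    exact ⟨A ∪ B, add_mem (modes_mono (by simp) hA) (modes_mono (by simp) hB)⟩
  | wedge_mul x a hx =>
    obtain ⟨A, hA⟩ := hx
    refine ⟨A ∪ a.support, mul_mem ?_ (modes_mono (by simp) hA)⟩
    rw [wedge_eq_sum_mode]
    refine sum_mem fun k hk => Subalgebra.smul_mem _ (mode_mem ?_) _
    rw [Finset.coe_union]
    exact Or.inr hk

/-- A subspace of Fock space that is stable under all creation and annihilation operators is
trivial. -/
theorem eq_top_of_creation_annihilation (N : Submodule ℂ (Fock K)) (hN : N ≠ ⊥)
    (hc : ∀ k, ∀ x ∈ N, mode k * x ∈ N)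
    (ha : ∀ k, ∀ x ∈ N, contract (Finsupp.lapply k) x ∈ N) : N = ⊤ := by
  classical
  -- Induction on the modes that occur in `x = y + mode k * z`: contraction with `k` extracts `z`,
  -- and if `z = 0` then `x = y` already avoids `k`. What remains at the end is a nonzero scalar.
  have key : ∀ A : Finset K, ∀ x ∈ N, x ≠ 0 → x ∈ modes (A : Set K) → 1 ∈ N := by
    intro A
    induction A using Finset.induction_on with
    | empty =>
      intro x hx h0 hA
      rw [modes, Finset.coe_empty, Set.image_empty, Algebra.adjoin_empty] at hA
      obtain ⟨r, rfl⟩ := Algebra.mem_bot.mp hA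
      have hr : r ≠ 0 := by
        rintro rfl
        exact h0 (map_zero _)
      have := N.smul_mem r⁻¹ hx
      rwa [Algebra.algebraMap_eq_smul_one, smul_smul, inv_mul_cancel₀ hr, one_smul] at this
    | insert k A hk ih =>
      intro x hx h0 hA
      rw [Finset.coe_insert] at hA
      obtain ⟨y, hy, z, hz, rfl⟩ := exists_eq_add_mode_mul hA
      have hk' : k ∉ (A : Set K) := hk
      have hd : contract (Finsupp.lapply k) (y + mode k * z) = z := by
        rw [map_add, contract_eq_zero_of_mem_modes hk' hy, mode, contract_wedge_mul,
          contract_eq_zero_of_mem_modes hk' hz]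
        simp
      by_cases hz0 : z = 0
      · subst hz0
        rw [mul_zero, add_zero] at hx h0
        exact ih y hx h0 hy
      · exact ih z (hd ▸ ha k _ hx) hz0 hz
  obtain ⟨x, hx, h0⟩ := N.ne_bot_iff.mp hN
  obtain ⟨A, hA⟩ := exists_finset_mem_modes x
  have h1 := key A x hx h0 hA
  rw [eq_top_iff]
  rintro x -
  induction x using Fock.left_induction with
  | scalar r =>
    rw [Algebra.algebraMap_eq_smul_one]
    exact N.smul_mem r h1
  | add x y hx hy => exact N.add_mem hx hy
  | wedge_mul x a hx =>
    rw [wedge_eq_sum_mode, Finset.sum_mul]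
    refine sum_mem fun k _ => ?_
    rw [smul_mul_assoc]
    exact N.smul_mem _ (hc k x hx)

/-! Each mode `k` carries the two Majorana operators with indices `e.symm (k, false)` and
`e.symm (k, true)`, namely `a† + a` and `-√-1 (a† - a)`. -/

variable (e : ι ≃ K × Bool)

/-- The coefficient of the creation operator in a Majorana operator. -/
def phase (b : Bool) : ℂ := if b then -Complex.I else 1

/-- The creation part of the Majorana operators. -/
def creationPart : (ι →₀ ℂ) →ₗ[ℂ] (K →₀ ℂ) :=
  Finsupp.linearCombination ℂ fun j => Finsupp.single (e j).1 (phase (e j).2)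

/-- The annihilation part of the Majorana operators. -/
def annihilationPart : (ι →₀ ℂ) →ₗ[ℂ] Module.Dual ℂ (K →₀ ℂ) :=
  Finsupp.linearCombination ℂ fun j => (phase (e j).2)⁻¹ • Finsupp.lapply (e j).1

/-- This scalar is the square of `a† + a` type operators. The two operators of one mode anticommute
because the cross terms `-√-1` and `(-√-1)⁻¹ = √-1` cancel; different modes do not interact. -/
theorem annihilationPart_creationPart (x : ι →₀ ℂ) :
    annihilationPart e x (creationPart e x) = sumSqForm ι x := by
  classical
  refine apply_self_eq_sumSqForm ((LinearMap.lcomp ℂ ℂ (creationPart e)).comp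
    (annihilationPart e)) (fun j l => ?_) x
  obtain ⟨⟨k, b⟩, rfl⟩ := e.symm.surjective j
  obtain ⟨⟨k', b'⟩, rfl⟩ := e.symm.surjective l
  by_cases hk : k = k'
  · subst hk
    cases b <;> cases b' <;>
      simp [annihilationPart, creationPart, phase] <;> norm_num
  · simp [annihilationPart, creationPart, hk, Ne.symm hk]

/-- The operators by which the generators of the Clifford algebra act on Fock space. -/
def fockOperator : (ι →₀ ℂ) →ₗ[ℂ] Module.End ℂ (Fock K) :=
  (LinearMap.mul ℂ (Fock K)).comp (wedge.comp (creationPart e)) +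
    contract.comp (annihilationPart e)

theorem fockOperator_apply (x : ι →₀ ℂ) (y : Fock K) :
    fockOperator e x y = wedge (creationPart e x) * y + contract (annihilationPart e x) y := rfl

theorem fockOperator_mul_self (x : ι →₀ ℂ) :
    fockOperator e x * fockOperator e x = algebraMap ℂ _ (sumSqForm ι x) := by
  ext y
  rw [Module.End.mul_apply, Module.algebraMap_end_apply, ← annihilationPart_creationPart e x,
    fockOperator_apply, fockOperator_apply, mul_add, map_add, contract_wedge_mul,
    contract_contract, ← mul_assoc, wedge_mul_self, zero_mul]
  abel

/-- The Fock representation of the Clifford algebra. -/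
def fockRep : CliffordAlgebra (sumSqForm ι) →ₐ[ℂ] Module.End ℂ (Fock K) :=
  CliffordAlgebra.lift _ ⟨fockOperator e, fockOperator_mul_self e⟩

theorem fockRep_ι (x : ι →₀ ℂ) : fockRep e (CliffordAlgebra.ι _ x) = fockOperator e x :=
  CliffordAlgebra.lift_ι_apply _ _ _

theorem fockRep_gen (j : ι) (y : Fock K) :
    fockRep e (gen j) y = phase (e j).2 • (mode (e j).1 * y) +
      (phase (e j).2)⁻¹ • contract (Finsupp.lapply (e j).1) y := by
  rw [gen, fockRep_ι, fockOperator_apply]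
  simp only [creationPart, annihilationPart, Finsupp.linearCombination_single, one_smul, map_smul,
    LinearMap.smul_apply, wedge_single, smul_mul_assoc]

theorem parity_fockRep_gen (j : ι) (y : Fock K) :
    parity (fockRep e (gen j) y) = -fockRep e (gen j) (parity y) := by
  rw [fockRep_gen, fockRep_gen, contract_parity, map_add, map_smul, map_smul, map_mul, mode,
    parity_wedge]
  simp only [neg_mul, smul_neg]
  abel

/-- The operator is `(a† + a)(a† - a) = 1 - 2 a†a`, and the vacuum has occupation number zero. -/
theorem fockRep_vacuum (k : K) :
    fockRep e (Complex.I • (gen (e.symm (k, false)) * gen (e.symm (k, true)))) 1 = 1 := by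
  rw [map_smul, map_mul, LinearMap.smul_apply, Module.End.mul_apply, fockRep_gen, fockRep_gen]
  simp only [Equiv.apply_symm_apply, phase, contract_one, map_smul, mul_one, smul_zero,
    add_zero, mul_smul_comm, mode, wedge_mul_self, ite_true, Bool.false_eq_true, ite_false]
  have := contract_wedge_mul (Finsupp.lapply k) (Finsupp.single k (1 : ℂ)) 1
  rw [mul_one] at this
  simp [this, contract_one, smul_smul]

/-- The Fock representation is irreducible. -/
theorem fockRep_irreducible (N : Submodule ℂ (Fock K)) (hN : N ≠ ⊥)
    (h : ∀ j, ∀ x ∈ N, fockRep e (gen j) x ∈ N) : N = ⊤ := by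
  refine eq_top_of_creation_annihilation N hN (fun k x hx => ?_) (fun k x hx => ?_)
  · have h0 := h (e.symm (k, false)) x hx
    have h1 := h (e.symm (k, true)) x hx
    rw [fockRep_gen, Equiv.apply_symm_apply] at h0 h1
    -- With `c = a† + a` and `c' = -√-1 (a† - a)`, one has `a† = (c + √-1 c') / 2` and, below, `a =
    -- (c - √-1 c') / 2`.
    convert N.smul_mem (1 / 2 : ℂ) (add_mem h0 (N.smul_mem Complex.I h1)) using 1
    simp only [phase, ite_true, Bool.false_eq_true, ite_false, smul_add, smul_smul]
    simp only [inv_neg, Complex.inv_I]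
    match_scalars <;> (ring_nf; simp <;> norm_num)
  · have h0 := h (e.symm (k, false)) x hx
    have h1 := h (e.symm (k, true)) x hx
    rw [fockRep_gen, Equiv.apply_symm_apply] at h0 h1
    convert N.smul_mem (1 / 2 : ℂ) (sub_mem h0 (N.smul_mem Complex.I h1)) using 1
    simp only [phase, ite_true, Bool.false_eq_true, ite_false, smul_add, smul_smul, smul_sub]
    simp only [inv_neg, Complex.inv_I]
    match_scalars <;> (ring_nf; simp <;> norm_num)

end Fock

/-! ### Coordinates on the diamond crystal -/

section Crystal

variable {d : ℕ}

theorem rootLattice_apply_int {x : W d} (hx : x ∈ rootLattice d) (j : Fin (d + 1)) :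
    ∃ n : ℤ, x.1 j = n := by
  induction hx using AddSubgroup.closure_induction with
  | mem x hx =>
    obtain ⟨i, rfl⟩ := hx
    refine ⟨(Pi.single i.castSucc 1 - Pi.single (Fin.last d) 1 : Fin (d + 1) → ℤ) j, ?_⟩
    simp [alpha, Pi.single_apply]
  | zero => exact ⟨0, by simp⟩
  | add x y _ _ hx hy =>
    obtain ⟨m, hm⟩ := hx
    obtain ⟨n, hn⟩ := hy
    exact ⟨m + n, by simp [hm, hn]⟩
  | neg x _ hx =>
    obtain ⟨m, hm⟩ := hx
    exact ⟨-m, by simp [hm]⟩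

theorem shift_apply_castSucc (j : Fin d) : (shift d).1 j.castSucc = ((d : ℝ) + 1)⁻¹ := by
  simp [shift, alpha, Finset.sum_apply, Pi.single_apply, Fin.castSucc_ne_last]

/-- Lattice vectors have integral coordinates, whereas `p` has a coordinate `1/(d + 1)`. This keeps
the two sublattices disjoint. -/
theorem shift_notMem_rootLattice (hd : 0 < d) : shift d ∉ rootLattice d := by
  intro h
  obtain ⟨n, hn⟩ := rootLattice_apply_int h (Fin.castSucc ⟨0, hd⟩)
  rw [shift_apply_castSucc] at hn
  have h1 : ((d : ℤ) + 1) * n = 1 := by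
    have : ((d : ℝ) + 1) * n = 1 := by rw [← hn, mul_inv_cancel₀ (by positivity)]
    exact_mod_cast this
  have h2 := Int.eq_one_or_neg_one_of_mul_eq_one h1
  omega

/-- The vertex `l` of the sublattice `A_d`. -/
def lower (l : rootLattice d) : Vertex d := ⟨l, Or.inl l.2⟩

/-- The vertex `l + p` of the sublattice `A_d + p`. -/
def upper (l : rootLattice d) : Vertex d := ⟨l + shift d, Or.inr (by simp)⟩

theorem lower_injective : Function.Injective (lower (d := d)) := fun _ _ h =>
  Subtype.ext (congrArg (fun v : Vertex d => v.1) h)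

theorem upper_injective : Function.Injective (upper (d := d)) := fun _ _ h =>
  Subtype.ext (add_right_cancel (congrArg Subtype.val h))

theorem lower_ne_upper (hd : 0 < d) (l m : rootLattice d) : lower l ≠ upper m := by
  intro h
  have h1 : (l : W d) = m + shift d := congrArg Subtype.val h
  apply shift_notMem_rootLattice hd
  rw [← sub_eq_iff_eq_add'.mpr h1]
  exact sub_mem l.2 m.2

theorem lower_or_upper (v : Vertex d) : (∃ l, v = lower l) ∨ ∃ l, v = upper l := by
  obtain ⟨x, hx | hx⟩ := v
  · exact Or.inl ⟨⟨x, hx⟩, rfl⟩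
  · exact Or.inr ⟨⟨x - shift d, hx⟩, Subtype.ext (by simp [upper])⟩

/-- The vertices of the crystal are the disjoint union of two copies of the root lattice. -/
def vertexEquiv (hd : 0 < d) : rootLattice d ⊕ rootLattice d ≃ Vertex d :=
  Equiv.ofBijective (Sum.elim lower upper) ⟨by
    refine lower_injective.sumElim upper_injective fun l m => lower_ne_upper hd l m, by
    intro v
    rcases lower_or_upper v with ⟨l, rfl⟩ | ⟨l, rfl⟩
    · exact ⟨Sum.inl l, rfl⟩
    · exact ⟨Sum.inr l, rfl⟩⟩

theorem vertexEquiv_symm_lower (hd : 0 < d) (l : rootLattice d) :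
    (vertexEquiv hd).symm (lower l) = Sum.inl l := by
  rw [Equiv.symm_apply_eq]
  rfl

theorem vertexEquiv_symm_upper (hd : 0 < d) (l : rootLattice d) :
    (vertexEquiv hd).symm (upper l) = Sum.inr l := by
  rw [Equiv.symm_apply_eq]
  rfl

/-- The lattice vector `β_i + p`. -/
def step (i : Fin (d + 1)) : rootLattice d := ⟨beta i + shift d, beta_add_shift_mem i⟩

theorem step_zero : step (d := d) 0 = 0 := Subtype.ext (by simp [step, beta])

theorem coe_step_succ (i : Fin d) : (step i.succ : W d) = alpha i := by
  simp [step, beta]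

theorem translate_lower (i : Fin d) (l : rootLattice d) :
    translate i (lower l) = lower (l + step i.succ) :=
  Subtype.ext (by simp [translate, lower, coe_step_succ])

theorem translate_upper (i : Fin d) (l : rootLattice d) :
    translate i (upper l) = upper (l + step i.succ) :=
  Subtype.ext (by simp [translate, upper, coe_step_succ, add_right_comm])

/-- The edge from `l + p` in direction `i`. -/
def edge (l : rootLattice d) (i : Fin (d + 1)) : Edge d := ⟨l + shift d, by simp, i⟩

theorem exists_eq_edge (e : Edge d) : ∃ l i, e = edge l i := by
  obtain ⟨x, hx, i⟩ := e
  refine ⟨⟨x - shift d, hx⟩, i, ?_⟩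
  simp [edge]

theorem edge_source (l : rootLattice d) (i : Fin (d + 1)) : (edge l i).source = upper l := rfl

theorem edge_target (l : rootLattice d) (i : Fin (d + 1)) :
    (edge l i).target = lower (l + step i) :=
  Subtype.ext (by simp [edge, Edge.target, lower, step, add_assoc, add_comm (shift d)])

theorem source_ne_target (hd : 0 < d) (e : Edge d) : e.source ≠ e.target := by
  obtain ⟨l, i, rfl⟩ := exists_eq_edge e
  rw [edge_source, edge_target]
  exact (lower_ne_upper hd _ _).symm

/-- Provides a vertex outside the support of any finite combination of matter operators. -/
theorem infinite_vertex (hd : 0 < d) : Infinite (Vertex d) := by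
  refine Infinite.of_injective
    (fun n : ℕ => lower (n • step (d := d) (Fin.succ ⟨0, hd⟩))) fun m n h => ?_
  have h1 : m • alpha ⟨0, hd⟩ = n • alpha (d := d) ⟨0, hd⟩ := by
    have := congrArg (fun l : rootLattice d => (l : W d)) (lower_injective h)
    simpa only [AddSubgroup.coe_nsmul, coe_step_succ] using this
  have h2 := congrArg (fun x : W d => x.1 (Fin.castSucc ⟨0, hd⟩)) h1
  have h3 : (alpha (⟨0, hd⟩ : Fin d)).1 (Fin.castSucc ⟨0, hd⟩) = 1 := by
    simp [alpha, hd.ne']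
  have h4 : m • (1 : ℝ) = n • 1 := by
    rw [← h3]
    exact h2
  simpa using h4

/-- The lattice vector by which the partner of a Majorana operator with index `k` is displaced:
the operators with `k ≤ d + 1` are paired along the edges with label `k`, and the matter operators
within the unit cell. -/
def offset (k : Fin (d + 2)) : rootLattice d :=
  Fin.lastCases (motive := fun _ => rootLattice d) 0 step k

theorem offset_castSucc (i : Fin (d + 1)) : offset i.castSucc = step i := by
  simp [offset]

/-- The pairing of the Majorana operators into modes. -/
def majoranaPairing (hd : 0 < d) :
    Vertex d × Fin (d + 2) ≃ (rootLattice d × Fin (d + 2)) × Bool where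
  toFun x := Sum.elim (fun l => ((l - offset x.2, x.2), true)) (fun l => ((l, x.2), false))
    ((vertexEquiv hd).symm x.1)
  invFun y := (if y.2 then lower (y.1.1 + offset y.1.2) else upper y.1.1, y.1.2)
  left_inv := by
    rintro ⟨v, k⟩
    rcases lower_or_upper v with ⟨l, rfl⟩ | ⟨l, rfl⟩
    · simp [vertexEquiv_symm_lower]
    · simp [vertexEquiv_symm_upper]
  right_inv := by
    rintro ⟨⟨l, k⟩, b⟩
    cases b
    · simp [vertexEquiv_symm_upper]
    · simp [vertexEquiv_symm_lower]

theorem link_edge (hd : 0 < d) (l : rootLattice d) (i : Fin (d + 1)) :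
    link (edge l i) = Complex.I • (gen ((majoranaPairing hd).symm ((l, i.castSucc), false)) *
      gen ((majoranaPairing hd).symm ((l, i.castSucc), true))) := by
  rw [link, edge_source, edge_target]
  simp only [majoranaPairing, Equiv.coe_fn_symm_mk, offset_castSucc]
  rfl

end Crystal

/-! ### Existence of an irreducible representation with a gauge sector -/

theorem exists_irreducible_gaugeSector_ne_bot {d : ℕ} (hd : 0 < d) :
    ∃ (S : Type) (_ : AddCommGroup S) (_ : Module ℂ S) (_ : Module (MajoranaAlgebra d) S)
      (_ : IsScalarTower ℂ (MajoranaAlgebra d) S) (D : S →ₗ[ℂ] S),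
      IsSimpleModule (MajoranaAlgebra d) S ∧ IsTotalParity (d := d) D ∧
        gaugeSector (d := d) D ≠ ⊥ := by
  let K := rootLattice d × Fin (d + 2)
  let ρ := fockRep (majoranaPairing hd)
  let _ : Module (MajoranaAlgebra d) (Fock K) := Module.compHom (Fock K) ρ.toRingHom
  have hρ : ∀ (x : MajoranaAlgebra d) (y : Fock K), x • y = ρ x y := fun _ _ => rfl
  have tower : IsScalarTower ℂ (MajoranaAlgebra d) (Fock K) :=
    ⟨fun c x y => by rw [hρ, hρ, map_smul, LinearMap.smul_apply]⟩
  refine ⟨Fock K, inferInstance, inferInstance, inferInstance, tower, parity.toLinearMap,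
    ?_, ⟨fun u => parity_parity u, fun v k u => parity_fockRep_gen _ _ _⟩, ?_⟩
  · rw [isSimpleModule_iff]
    have : Nontrivial (Submodule (MajoranaAlgebra d) (Fock K)) :=
      (Submodule.nontrivial_iff _).mpr inferInstance
    refine ⟨fun N => or_iff_not_imp_left.mpr fun hN => ?_⟩
    have h := fockRep_irreducible (majoranaPairing hd) (N.restrictScalars ℂ)
      (by rwa [Ne, Submodule.restrictScalars_eq_bot_iff]) fun j x hx => N.smul_mem (gen j) hx
    rwa [Submodule.restrictScalars_eq_top_iff] at h
  · rw [Submodule.ne_bot_iff]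
    -- The vacuum has even parity, and every link operator is the pair operator of one mode.
    refine ⟨(1 : Fock K), ⟨map_one parity, fun e => ?_⟩, one_ne_zero⟩
    obtain ⟨l, i, rfl⟩ := exists_eq_edge e
    rw [hρ, link_edge hd]
    exact fockRep_vacuum _ _

/-! ### The commutator with the Hamiltonian -/

section Commutator

variable {d : ℕ}

theorem majorana_mul_self (v : Vertex d) (k : Fin (d + 2)) : majorana v k * majorana v k = 1 :=
  gen_mul_self (v, k)

theorem majorana_mul_majorana {v w : Vertex d} {k l : Fin (d + 2)} (h : (v, k) ≠ (w, l)) :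
    majorana v k * majorana w l = -(majorana w l * majorana v k) :=
  gen_mul_gen_of_ne h

theorem matter_mul_self (v : Vertex d) : matter v * matter v = 1 := majorana_mul_self v _

theorem matter_mul_matter {v w : Vertex d} (h : v ≠ w) :
    matter v * matter w = -(matter w * matter v) :=
  majorana_mul_majorana fun h' => h (congrArg Prod.fst h')

theorem majorana_castSucc_mul_matter (v w : Vertex d) (k : Fin (d + 1)) :
    majorana v k.castSucc * matter w = -(matter w * majorana v k.castSucc) :=
  majorana_mul_majorana fun h => Fin.castSucc_ne_last k (congrArg Prod.snd h)

/-- A link operator is a product of two generators, both different from every matter operator, so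
the two signs cancel. -/
theorem link_mul_matter (e : Edge d) (v : Vertex d) : link e * matter v = matter v * link e := by
  rw [link, smul_mul_assoc, mul_smul_comm, mul_assoc, majorana_castSucc_mul_matter, mul_neg,
    ← mul_assoc, majorana_castSucc_mul_matter, neg_mul, neg_neg, mul_assoc]

/-- Isolates the gauge factor: once the link acts as 1, the term is quadratic in the matter
operators. -/
theorem hamiltonianTerm_eq (J : Fin (d + 1) → ℝ) (e : Edge d) :
    hamiltonianTerm J e =
      (Complex.I * J e.dir) • (matter e.source * matter e.target * link e) := by
  have h : spin e.source e.dir * spin e.target e.dir =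
      -(Complex.I • (matter e.source * matter e.target * link e)) := by
    have h1 := majorana_castSucc_mul_matter e.source e.source e.dir
    have h2 := majorana_castSucc_mul_matter e.target e.target e.dir
    have h3 := majorana_castSucc_mul_matter e.source e.target e.dir
    simp only [spin, link, smul_mul_assoc, mul_smul_comm]
    rw [← smul_neg, ← smul_neg, h1, h2, neg_mul_neg, mul_assoc, ← mul_assoc (majorana _ _), h3]
    simp only [neg_mul, mul_neg, mul_assoc]
  rw [hamiltonianTerm, h, smul_neg, neg_neg, smul_smul, mul_comm Complex.I]

theorem commutator_term_of_ne (J : Fin (d + 1) → ℝ) {e : Edge d} {v : Vertex d}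
    (hs : e.source ≠ v) (ht : e.target ≠ v) :
    hamiltonianTerm J e * matter v - matter v * hamiltonianTerm J e = 0 := by
  rw [hamiltonianTerm_eq, smul_mul_assoc, mul_smul_comm, ← smul_sub, mul_assoc, link_mul_matter,
    ← mul_assoc, mul_assoc (matter _), matter_mul_matter ht, mul_neg, ← mul_assoc,
    matter_mul_matter hs]
  simp [mul_assoc]

theorem commutator_term_target (hd : 0 < d) (J : Fin (d + 1) → ℝ) (e : Edge d) :
    hamiltonianTerm J e * matter e.target - matter e.target * hamiltonianTerm J e =
      (2 * Complex.I * J e.dir) • (matter e.source * link e) := by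
  rw [hamiltonianTerm_eq, smul_mul_assoc, mul_smul_comm, ← smul_sub, mul_assoc, link_mul_matter,
    ← mul_assoc, mul_assoc (matter _), matter_mul_self, mul_one, ← mul_assoc, ← mul_assoc,
    matter_mul_matter (source_ne_target hd e).symm, neg_mul, mul_assoc (matter e.source),
    matter_mul_self, mul_one, neg_mul, sub_neg_eq_add, ← two_smul ℂ, smul_smul]
  congr 1
  ring

theorem commutator_term_source (hd : 0 < d) (J : Fin (d + 1) → ℝ) (e : Edge d) :
    hamiltonianTerm J e * matter e.source - matter e.source * hamiltonianTerm J e =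
      (-(2 * Complex.I * J e.dir)) • (matter e.target * link e) := by
  rw [hamiltonianTerm_eq, smul_mul_assoc, mul_smul_comm, ← smul_sub, mul_assoc, link_mul_matter,
    ← mul_assoc, mul_assoc (matter _), matter_mul_matter (source_ne_target hd e).symm, mul_neg,
    ← mul_assoc, ← mul_assoc, ← mul_assoc, matter_mul_self, one_mul, neg_mul, ← neg_add',
    ← two_smul ℂ, smul_neg, smul_smul, neg_smul]
  congr 2
  ring

theorem finsum_eq_sum_comp {α β M : Type*} [Fintype β] [AddCommMonoid M] {g : β → α}
    (hg : Function.Injective g) (f : α → M) (hf : ∀ a, a ∉ Set.range g → f a = 0) :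
    ∑ᶠ a, f a = ∑ b, f (g b) := by
  classical
  rw [finsum_eq_finsetSum_of_support_subset (s := Finset.univ.image g), Finset.sum_image hg.injOn]
  intro a ha
  by_contra h
  exact ha (hf a (by simpa using h))

theorem commutatorH_lower (hd : 0 < d) (J : Fin (d + 1) → ℝ) (l : rootLattice d) :
    commutatorH J (matter (lower l)) = ∑ i, (2 * Complex.I * J i) •
      (matter (upper (l - step i)) * link (edge (l - step i) i)) := by
  have ht : ∀ i, (edge (l - step i) i).target = lower l := fun i => by
    rw [edge_target, sub_add_cancel]
  rw [commutatorH, finsum_eq_sum_comp (g := fun i => edge (l - step i) i)]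
  · refine Finset.sum_congr rfl fun i _ => ?_
    have h := commutator_term_target hd J (edge (l - step i) i)
    rwa [ht] at h
  · exact fun i j h => congrArg Edge.dir h
  · intro e he
    obtain ⟨m, i, rfl⟩ := exists_eq_edge e
    refine commutator_term_of_ne J (lower_ne_upper hd _ _).symm fun h => he ⟨i, ?_⟩
    rw [edge_target] at h
    simp [← lower_injective h]

theorem commutatorH_upper (hd : 0 < d) (J : Fin (d + 1) → ℝ) (l : rootLattice d) :
    commutatorH J (matter (upper l)) = ∑ i, (-(2 * Complex.I * J i)) •
      (matter (lower (l + step i)) * link (edge l i)) := by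
  rw [commutatorH, finsum_eq_sum_comp (g := fun i => edge l i)]
  · refine Finset.sum_congr rfl fun i _ => ?_
    have h := commutator_term_source hd J (edge l i)
    rwa [edge_target] at h
  · exact fun i j h => congrArg Edge.dir h
  · intro e he
    obtain ⟨m, i, rfl⟩ := exists_eq_edge e
    refine commutator_term_of_ne J (fun h => he ⟨i, ?_⟩) ?_
    · rw [upper_injective h]
    · rw [edge_target]
      exact lower_ne_upper hd _ _

theorem matter_anticomm_smul {S : Type*} [AddCommGroup S] [Module ℂ S]
    [Module (MajoranaAlgebra d) S] (v w : Vertex d) (u : S) :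
    matter v • matter w • u =
      (2 * Finsupp.single v (1 : ℂ) w) • u - matter w • matter v • u := by
  classical
  by_cases h : v = w
  · subst h
    rw [← mul_smul, matter_mul_self, one_smul, Finsupp.single_eq_same, mul_one, two_smul,
      add_sub_cancel_right]
  · rw [Finsupp.single_eq_of_ne (Ne.symm h), mul_zero, zero_smul, zero_sub, ← mul_smul,
      matter_mul_matter h, neg_smul, mul_smul]

end Commutator

/-! ### The matrix of the Hamiltonian -/

section Matrix

variable {d : ℕ} {S : Type*} [AddCommGroup S] [Module ℂ S] [Module (MajoranaAlgebra d) S]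
  [IsScalarTower ℂ (MajoranaAlgebra d) S]

/-- The matrix by which the Hamiltonian acts on the matter operators in the trivial gauge. -/
def hamiltonianMatrix (hd : 0 < d) (J : Fin (d + 1) → ℝ) (v : Vertex d) : Vertex d →₀ ℂ :=
  Sum.elim
    (fun l => ∑ i, Finsupp.single (upper (l - step i)) (2 * Complex.I * J i))
    (fun l => ∑ i, Finsupp.single (lower (l + step i)) (-(2 * Complex.I * J i)))
    ((vertexEquiv hd).symm v)

theorem hamiltonianMatrix_lower (hd : 0 < d) (J : Fin (d + 1) → ℝ) (l : rootLattice d) :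
    hamiltonianMatrix hd J (lower l) =
      ∑ i, Finsupp.single (upper (l - step i)) (2 * Complex.I * J i) := by
  rw [hamiltonianMatrix, vertexEquiv_symm_lower]
  rfl

theorem hamiltonianMatrix_upper (hd : 0 < d) (J : Fin (d + 1) → ℝ) (l : rootLattice d) :
    hamiltonianMatrix hd J (upper l) =
      ∑ i, Finsupp.single (lower (l + step i)) (-(2 * Complex.I * J i)) := by
  rw [hamiltonianMatrix, vertexEquiv_symm_upper]
  rfl

theorem smul_smul_comm_majorana (c : ℂ) (x : MajoranaAlgebra d) (u : S) :
    x • c • u = c • x • u := by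
  rw [← algebraMap_smul (MajoranaAlgebra d) c u, ← mul_smul, ← Algebra.commutes, mul_smul,
    algebraMap_smul]

theorem isMatrixOfH_hamiltonianMatrix (hd : 0 < d) (J : Fin (d + 1) → ℝ) (D : S →ₗ[ℂ] S) :
    IsMatrixOfH J D (hamiltonianMatrix hd J) := by
  classical
  intro v u hu
  rcases lower_or_upper v with ⟨l, rfl⟩ | ⟨l, rfl⟩
  · rw [commutatorH_lower hd, hamiltonianMatrix_lower, Finset.sum_smul,
      ← Finsupp.sum_finsetSum_index (by simp) (by intros; rw [add_smul])]
    refine Finset.sum_congr rfl fun i _ => ?_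
    rw [Finsupp.sum_single_index (by simp), smul_assoc (_ : ℂ) (_ * _) u, mul_smul (matter _), hu.2]
  · rw [commutatorH_upper hd, hamiltonianMatrix_upper, Finset.sum_smul,
      ← Finsupp.sum_finsetSum_index (by simp) (by intros; rw [add_smul])]
    refine Finset.sum_congr rfl fun i _ => ?_
    rw [Finsupp.sum_single_index (by simp), smul_assoc (_ : ℂ) (_ * _) u, mul_smul (matter _), hu.2]

/-- Each matter operator flips the total parity and commutes with the links; two flips restore the
sector. -/
theorem matter_matter_smul_mem_gaugeSector {D : S →ₗ[ℂ] S} (hD : IsTotalParity (d := d) D)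
    (v w : Vertex d) {u : S} (hu : u ∈ gaugeSector (d := d) D) :
    matter v • matter w • u ∈ gaugeSector (d := d) D := by
  refine ⟨?_, fun e => ?_⟩
  · rw [matter, hD.2, matter, hD.2, hu.1, smul_neg, neg_neg]
  · rw [← mul_smul, link_mul_matter, mul_smul, ← mul_smul (link e),
      link_mul_matter, mul_smul, hu.2]

theorem sum_matter_anticomm_smul (a : Vertex d →₀ ℂ) (w : Vertex d) (u : S) :
    (a.sum fun v c => c • matter v • matter w • u) =
      (2 * a w) • u - matter w • a.sum fun v c => c • matter v • u := by
  classical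
  have h : a.sum (fun v c => c * (2 * Finsupp.single v (1 : ℂ) w)) = 2 * a w := by
    by_cases hw : w ∈ a.support
    · rw [Finsupp.sum, Finset.sum_eq_single_of_mem w hw]
      · simp [mul_comm]
      · intro v _ hv
        simp [Finsupp.single_eq_of_ne (Ne.symm hv)]
    · rw [Finsupp.notMem_support_iff.mp hw, mul_zero]
      refine Finset.sum_eq_zero fun v hv => ?_
      have : w ≠ v := fun h => hw (h ▸ hv)
      simp [Finsupp.single_eq_of_ne this]
  rw [← h, Finsupp.sum, Finsupp.sum, Finsupp.sum, Finset.sum_smul, Finset.smul_sum,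
    ← Finset.sum_sub_distrib]
  refine Finset.sum_congr rfl fun v _ => ?_
  rw [matter_anticomm_smul, smul_sub, smul_smul, smul_smul_comm_majorana]

/-- A combination of matter operators that annihilates a nonzero gauge sector is trivial. -/
theorem eq_zero_of_annihilates_gaugeSector (hd : 0 < d) {D : S →ₗ[ℂ] S}
    (hD : IsTotalParity (d := d) D) (hM : gaugeSector (d := d) D ≠ ⊥) (a : Vertex d →₀ ℂ)
    (ha : ∀ u ∈ gaugeSector (d := d) D, (a.sum fun v c => c • matter v • u) = 0) : a = 0 := by
  have := infinite_vertex hd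
  obtain ⟨u, hu, hu0⟩ := (Submodule.ne_bot_iff _).mp hM
  -- The test vector `c_w c_v u` needs a second matter operator to stay in the sector. Moving the
  -- combination to the right past `c_w` and `c_v` leaves `2 a_w c_v u - 2 a_v c_w u`, up to a term
  -- in which it hits `u` and vanishes; choosing `a_v = 0` isolates `a_w`.
  obtain ⟨v, hv⟩ := Infinite.exists_notMem_finset a.support
  rw [Finsupp.notMem_support_iff] at hv
  ext w
  have h1 := ha _ (matter_matter_smul_mem_gaugeSector hD w v hu)
  rw [sum_matter_anticomm_smul, sum_matter_anticomm_smul, ha u hu, hv] at h1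
  simp only [mul_zero, zero_smul, smul_zero, sub_zero] at h1
  have h2 : matter v • matter v • u = u := by rw [← mul_smul, matter_mul_self, one_smul]
  rcases smul_eq_zero.mp h1 with h | h
  · simpa using h
  · exact absurd (by rw [← h2, h, smul_zero]) hu0

theorem IsMatrixOfH.unique (hd : 0 < d) {J : Fin (d + 1) → ℝ} {D : S →ₗ[ℂ] S}
    (hD : IsTotalParity (d := d) D) (hM : gaugeSector (d := d) D ≠ ⊥)
    {h h' : Vertex d → Vertex d →₀ ℂ} (hh : IsMatrixOfH J D h) (hh' : IsMatrixOfH J D h') :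
    h = h' := by
  funext v
  rw [← sub_eq_zero]
  refine eq_zero_of_annihilates_gaugeSector hd hD hM _ fun u hu => ?_
  rw [Finsupp.sum_sub_index (by intros; rw [sub_smul]), ← hh v u hu, ← hh' v u hu, sub_self]

/-! ### Energies -/

theorem finsum_sum_single_smul {α β E : Type*} [Fintype β] [AddCommGroup E] [Module ℂ E]
    (g : β → α) (c : β → ℂ) (f : α → E) (r : α → ℂ)
    (hr : ∀ a, r a = ∑ b, Finsupp.single (g b) (c b) a) :
    ∑ᶠ a, r a • f a = ∑ b, c b • f (g b) := by
  classical
  simp only [hr, Finset.sum_smul]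
  rw [finsum_sum_comm]
  · refine Finset.sum_congr rfl fun b _ => ?_
    rw [finsum_eq_single _ (g b), Finsupp.single_eq_same]
    intro a ha
    rw [Finsupp.single_eq_of_ne ha, zero_smul]
  · intro b _
    refine (Set.finite_singleton (g b)).subset fun a ha => ?_
    by_contra h
    exact ha (by simp only [Finsupp.single_eq_of_ne (show a ≠ g b from h), zero_smul])

variable {n : ℕ}

theorem hamiltonianMatrix_action_upper (hd : 0 < d) (J : Fin (d + 1) → ℝ)
    (f : Vertex d → EuclideanSpace ℂ (Fin n)) (l : rootLattice d) :
    ∑ᶠ v, hamiltonianMatrix hd J v (upper l) • f v =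
      ∑ i, (2 * Complex.I * J i) • f (lower (l + step i)) := by
  classical
  refine finsum_sum_single_smul (fun i => lower (l + step i)) (fun i => 2 * Complex.I * J i) f _
    fun v => ?_
  rcases lower_or_upper v with ⟨m, rfl⟩ | ⟨m, rfl⟩
  · rw [hamiltonianMatrix_lower, Finsupp.finsetSum_apply]
    refine Finset.sum_congr rfl fun i _ => ?_
    rw [Finsupp.single_apply, Finsupp.single_apply, upper_injective.eq_iff,
      lower_injective.eq_iff, sub_eq_iff_eq_add, eq_comm (a := m)]
  · rw [hamiltonianMatrix_upper, Finsupp.finsetSum_apply]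
    refine Finset.sum_congr rfl fun i _ => ?_
    rw [Finsupp.single_eq_of_ne (lower_ne_upper hd _ _).symm,
      Finsupp.single_eq_of_ne (lower_ne_upper hd _ _).symm]

theorem hamiltonianMatrix_action_lower (hd : 0 < d) (J : Fin (d + 1) → ℝ)
    (f : Vertex d → EuclideanSpace ℂ (Fin n)) (l : rootLattice d) :
    ∑ᶠ v, hamiltonianMatrix hd J v (lower l) • f v =
      ∑ i, (-(2 * Complex.I * J i)) • f (upper (l - step i)) := by
  classical
  refine finsum_sum_single_smul (fun i => upper (l - step i)) (fun i => -(2 * Complex.I * J i)) f _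
    fun v => ?_
  rcases lower_or_upper v with ⟨m, rfl⟩ | ⟨m, rfl⟩
  · rw [hamiltonianMatrix_lower, Finsupp.finsetSum_apply]
    refine Finset.sum_congr rfl fun i _ => ?_
    rw [Finsupp.single_eq_of_ne (lower_ne_upper hd _ _),
      Finsupp.single_eq_of_ne (lower_ne_upper hd _ _)]
  · rw [hamiltonianMatrix_upper, Finsupp.finsetSum_apply]
    refine Finset.sum_congr rfl fun i _ => ?_
    rw [Finsupp.single_apply, Finsupp.single_apply, upper_injective.eq_iff,
      lower_injective.eq_iff, sub_eq_iff_eq_add, eq_comm (a := l)]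

/-- The character `exp(√-1 q)` of `W`. -/
def character (q : Module.Dual ℝ (W d)) (x : W d) : ℂ := Complex.exp (Complex.I * (q x : ℂ))

theorem character_zero (q : Module.Dual ℝ (W d)) : character q 0 = 1 := by simp [character]

theorem character_add (q : Module.Dual ℝ (W d)) (x y : W d) :
    character q (x + y) = character q x * character q y := by
  rw [character, character, character, ← Complex.exp_add, map_add]
  push_cast
  ring_nf

theorem conj_character (q : Module.Dual ℝ (W d)) (x : W d) :
    (starRingEnd ℂ) (character q x) = character q (-x) := by
  rw [character, character, ← Complex.exp_conj]
  simp

theorem character_neg_mul_cancel (q : Module.Dual ℝ (W d)) (x : W d) :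
    character q (-x) * character q x = 1 := by
  rw [← character_add, neg_add_cancel, character_zero]

/-- Puts the Bloch condition in the form met in the rows of the matrix: neighbours of an upper
vertex are displaced by `step i`, those of a lower vertex by `-step i`. The direction `i = 0` adds
nothing, since `step 0 = 0`. -/
theorem isBloch_iff (q : Module.Dual ℝ (W d)) (f : Vertex d → EuclideanSpace ℂ (Fin n)) :
    IsBloch q f ↔ ∀ (i : Fin (d + 1)) (l : rootLattice d),
      f (lower (l + step i)) = character q (step i) • f (lower l) ∧
      f (upper (l - step i)) = character q (-step i) • f (upper l) := by
  constructor
  · intro hf i l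
    have h : ∀ m, f (lower (m + step i)) = character q (step i) • f (lower m) ∧
        f (upper (m + step i)) = character q (step i) • f (upper m) := by
      intro m
      cases i using Fin.cases with
      | zero => simp [step_zero, character_zero]
      | succ i =>
        rw [← translate_lower, ← translate_upper, coe_step_succ]
        exact ⟨hf i _, hf i _⟩
    refine ⟨(h l).1, ?_⟩
    have h2 := (h (l - step i)).2
    rw [sub_add_cancel] at h2
    rw [h2, smul_smul, character_neg_mul_cancel, one_smul]
  · intro hf i v
    change _ = character q _ • _
    rw [← coe_step_succ]
    rcases lower_or_upper v with ⟨l, rfl⟩ | ⟨l, rfl⟩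
    · rw [translate_lower, (hf _ _).1]
    · have h := (hf i.succ (l + step i.succ)).2
      rw [add_sub_cancel_right] at h
      rw [translate_upper, h, smul_smul, mul_comm, character_neg_mul_cancel, one_smul]

/-- The structure function `J_1 + ∑ J_{i+1} exp(√-1 q·α_i)`. -/
def structureFunction (J : Fin (d + 1) → ℝ) (q : Module.Dual ℝ (W d)) : ℂ :=
  ∑ i, (J i : ℂ) * character q (step i)

theorem structureFunction_eq (J : Fin (d + 1) → ℝ) (q : Module.Dual ℝ (W d)) :
    structureFunction J q =
      (J 0 : ℂ) + ∑ i : Fin d, (J i.succ : ℂ) * Complex.exp (Complex.I * (q (alpha i) : ℂ)) := by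
  rw [structureFunction, Fin.sum_univ_succ, step_zero]
  simp only [coe_step_succ, AddSubgroup.coe_zero, character_zero, mul_one]
  rfl

theorem conj_structureFunction (J : Fin (d + 1) → ℝ) (q : Module.Dual ℝ (W d)) :
    (starRingEnd ℂ) (structureFunction J q) = ∑ i, (J i : ℂ) * character q (-step i) := by
  simp only [structureFunction, map_sum, map_mul, Complex.conj_ofReal, conj_character]

/-- On Bloch functions the eigenvalue equation reduces to a two-by-two system in every cell. -/
theorem eigen_iff_of_isBloch (hd : 0 < d) (J : Fin (d + 1) → ℝ) {q : Module.Dual ℝ (W d)}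
    {f : Vertex d → EuclideanSpace ℂ (Fin n)} (hf : IsBloch q f) (ξ : ℂ) :
    (∀ w, ∑ᶠ v, hamiltonianMatrix hd J v w • f v = ξ • f w) ↔
      ∀ l, (2 * Complex.I * structureFunction J q) • f (lower l) = ξ • f (upper l) ∧
        (-(2 * Complex.I * (starRingEnd ℂ) (structureFunction J q))) • f (upper l) =
          ξ • f (lower l) := by
  rw [isBloch_iff] at hf
  have hu : ∀ l, ∑ᶠ v, hamiltonianMatrix hd J v (upper l) • f v =
      (2 * Complex.I * structureFunction J q) • f (lower l) := fun l => by
    rw [hamiltonianMatrix_action_upper, structureFunction, Finset.mul_sum, Finset.sum_smul]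
    refine Finset.sum_congr rfl fun i _ => ?_
    rw [(hf i l).1, smul_smul, mul_assoc (2 * Complex.I)]
  have hl : ∀ l, ∑ᶠ v, hamiltonianMatrix hd J v (lower l) • f v =
      (-(2 * Complex.I * (starRingEnd ℂ) (structureFunction J q))) • f (upper l) := fun l => by
    rw [hamiltonianMatrix_action_lower, conj_structureFunction, Finset.mul_sum,
      ← Finset.sum_neg_distrib, Finset.sum_smul]
    refine Finset.sum_congr rfl fun i _ => ?_
    rw [(hf i l).2, smul_smul, neg_mul, mul_assoc (2 * Complex.I)]
  refine ⟨fun h l => ⟨?_, ?_⟩, fun h w => ?_⟩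
  · rw [← hu, h]
  · rw [← hl, h]
  · rcases lower_or_upper w with ⟨l, rfl⟩ | ⟨l, rfl⟩
    · rw [hl, (h l).2]
    · rw [hu, (h l).1]

theorem sq_eq_four_mul_normSq_iff (z ξ : ℂ) :
    ξ * ξ = 4 * (z * (starRingEnd ℂ) z) ↔
      ξ = ((2 * ‖z‖ : ℝ) : ℂ) ∨ ξ = ((-(2 * ‖z‖) : ℝ) : ℂ) := by
  rw [Complex.mul_conj, Complex.normSq_eq_norm_sq, Complex.ofReal_neg, ← sq_eq_sq_iff_eq_or_eq_neg]
  push_cast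
  rw [← sq, mul_pow]
  norm_num

/-- The right side is the vanishing of the determinant of the two-by-two system in a cell. The
system acts alike on all components of `f`, so one nonzero component suffices. -/
theorem exists_isBloch_eigenfunction_iff (hd : 0 < d) (J : Fin (d + 1) → ℝ)
    (q : Module.Dual ℝ (W d)) (ξ : ℂ) (hn : 0 < n) :
    (∃ f : Vertex d → EuclideanSpace ℂ (Fin n), f ≠ 0 ∧ IsBloch q f ∧
      ∀ w, ∑ᶠ v, hamiltonianMatrix hd J v w • f v = ξ • f w) ↔
    ξ * ξ = 4 * (structureFunction J q * (starRingEnd ℂ) (structureFunction J q)) := by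
  set z := structureFunction J q with hz
  have hI : Complex.I * Complex.I = -1 := Complex.I_mul_I
  constructor
  · rintro ⟨f, hf0, hf, h⟩
    rw [eigen_iff_of_isBloch hd J hf, ← hz] at h
    obtain ⟨w, hw⟩ := Function.ne_iff.mp hf0
    -- Applying the system twice returns to the same sublattice, so `ξ²` and `4|z|²` scale the
    -- nonzero vector `f w` equally.
    refine smul_left_injective ℂ hw ?_
    change (ξ * ξ) • f w = (4 * (z * (starRingEnd ℂ) z)) • f w
    rcases lower_or_upper w with ⟨l, rfl⟩ | ⟨l, rfl⟩
    · rw [mul_smul, ← (h l).2, smul_comm, ← (h l).1, smul_smul]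
      congr 1
      linear_combination (-4 * z * (starRingEnd ℂ) z) * hI
    · rw [mul_smul, ← (h l).1, smul_comm, ← (h l).2, smul_smul]
      congr 1
      linear_combination (-4 * z * (starRingEnd ℂ) z) * hI
  · intro hξ
    obtain ⟨a, b, hab, h1, h2⟩ : ∃ a b : ℂ, (a ≠ 0 ∨ b ≠ 0) ∧ 2 * Complex.I * z * a = ξ * b ∧
        -(2 * Complex.I * (starRingEnd ℂ) z) * b = ξ * a := by
      by_cases h0 : z = 0
      · have : ξ = 0 := by simpa [h0] using hξ
        exact ⟨1, 0, Or.inl one_ne_zero, by simp [h0], by simp [this]⟩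
      -- This pair solves the first equation identically, and the second becomes `4|z|² = ξ²`. It is
      -- nonzero only for `z ≠ 0`; for `z = 0` the system is trivial, as `ξ = 0`.
      · refine ⟨ξ, 2 * Complex.I * z, Or.inr (by simp [h0]), by ring, ?_⟩
        linear_combination (-4 * z * (starRingEnd ℂ) z) * hI - hξ
    let ε : EuclideanSpace ℂ (Fin n) := EuclideanSpace.single ⟨0, hn⟩ 1
    have hε : ε ≠ 0 := by simp [ε]
    let f : Vertex d → EuclideanSpace ℂ (Fin n) := fun v =>
      Sum.elim (fun l : rootLattice d => (character q l * a) • ε)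
        (fun l : rootLattice d => (character q l * b) • ε) ((vertexEquiv hd).symm v)
    have fl : ∀ l : rootLattice d, f (lower l) = (character q l * a) • ε := fun l => by
      simp only [f, vertexEquiv_symm_lower, Sum.elim_inl]
    have fu : ∀ l : rootLattice d, f (upper l) = (character q l * b) • ε := fun l => by
      simp only [f, vertexEquiv_symm_upper, Sum.elim_inr]
    have hf : IsBloch q f := by
      refine (isBloch_iff q f).mpr fun i l => ⟨?_, ?_⟩
      · rw [fl, fl, smul_smul, AddSubgroup.coe_add, character_add]
        congr 1
        ring
      · rw [fu, fu, smul_smul, AddSubgroup.coe_sub, sub_eq_add_neg, character_add]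
        congr 1
        ring
    refine ⟨f, fun h => ?_, hf, (eigen_iff_of_isBloch hd J hf ξ).mpr fun l => ?_⟩
    · have hl := congrFun h (lower 0)
      have hu := congrFun h (upper 0)
      rw [fl] at hl
      rw [fu] at hu
      simp [character_zero, hε] at hl hu
      exact hab.elim (fun h => h hl) (fun h => h hu)
    · rw [fl, fu, ← hz, smul_smul, smul_smul, smul_smul, smul_smul]
      refine ⟨?_, ?_⟩
      · congr 1
        linear_combination character q l * h1
      · congr 1
        linear_combination character q l * h2

end Matrix

end

end DiamondKitaev

open DiamondKitaev in
theorem theorem6p1 (d : ℕ) (hd : 2 ≤ d) (J : Fin (d + 1) → ℝ) :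
    (∃ (S : Type) (_ : AddCommGroup S) (_ : Module ℂ S) (_ : Module (MajoranaAlgebra d) S)
        (_ : IsScalarTower ℂ (MajoranaAlgebra d) S) (D : S →ₗ[ℂ] S),
        IsSimpleModule (MajoranaAlgebra d) S ∧ IsTotalParity (d := d) D ∧
          gaugeSector (d := d) D ≠ ⊥) ∧
    ∀ (S : Type*) [AddCommGroup S] [Module ℂ S] [Module (MajoranaAlgebra d) S]
      [IsScalarTower ℂ (MajoranaAlgebra d) S] (D : S →ₗ[ℂ] S),
      IsTotalParity (d := d) D → gaugeSector (d := d) D ≠ ⊥ →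
        (∃! h : Vertex d → Vertex d →₀ ℂ, IsMatrixOfH J D h) ∧
        ∀ (q : Module.Dual ℝ (W d)) (ξ : ℂ), IsEnergyAt J D q ξ ↔
          ξ = ((2 * ‖(J 0 : ℂ) + ∑ i : Fin d,
                (J i.succ : ℂ) * Complex.exp (Complex.I * (q (alpha i) : ℂ))‖ : ℝ) : ℂ) ∨
          ξ = ((-(2 * ‖(J 0 : ℂ) + ∑ i : Fin d,
                (J i.succ : ℂ) * Complex.exp (Complex.I * (q (alpha i) : ℂ))‖) : ℝ) : ℂ) := by
  have hd0 : 0 < d := by omega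
  refine ⟨exists_irreducible_gaugeSector_ne_bot hd0, fun S _ _ _ _ D hD hM => ?_⟩
  have hm := isMatrixOfH_hamiltonianMatrix hd0 J D
  refine ⟨⟨_, hm, fun h hh => hh.unique hd0 hD hM hm⟩, fun q ξ => ?_⟩
  rw [← structureFunction_eq, ← sq_eq_four_mul_normSq_iff,
    ← exists_isBloch_eigenfunction_iff hd0 J q ξ (n := 2 ^ (d / 2)) (by positivity)]
  constructor
  · rintro ⟨h, hh, hf⟩
    rwa [hh.unique hd0 hD hM hm] at hf
  · exact fun hf => ⟨_, hm, hf⟩
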